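/- Let $X$ be a compact connected (Hausdorff) complex manifold of dimension $k$, and let $\pi_1,\pi_2:X\times X\to X$ be the projections. Let $F$ be a holomorphic correspondence on $X$: a formal sum $\Gamma=\sum_{j=1}^N m_j\Gamma_j$ with $N\ge 1$, integers $m_j\ge 1$, and distinct irreducible complex subvarieties $\Gamma_j\subset X\times X$ of dimension $k$ such that $\pi_1|_{\Gamma_j}$ and $\pi_2|_{\Gamma_j}$ are surjective with finite fibres. Put $|\Gamma|=\bigcup_j\Gamma_j$, $F(A)=\pi_2(\pi_1^{-1}(A)\cap|\Gamma|)$, $F^{\dagger}(A)=\pi_1(\pi_2^{-1}(A)\cap|\Gamma|)$, $F^0(A)=A$ and $F^{n}(A)=F(F^{n-1}(A))$. Let $d$ be the topological degree of $F$, that is, the number of points of $F^{\dagger}(z)$ for generic $z\in X$, each component $\Gamma_j$ being counted $m_j$ times. Let $\mu$ be a Borel probability measure on $X$ that is $F^*$-invariant, i.e. $$\int_X \sum_{w\in F^{\dagger}(z)}{}^{'}\,\varphi(w)\,d\mu(z)=d\int_X\varphi\,d\mu\qquad\text{for all continuous }\varphi:X\to\mathbb{R},$$ where in $\sum'$ the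 points are repeated according to multiplicity: $w$ counts, for each $j$ with $(w,z)\in\Gamma_j$, $m_j$ times the local degree of $\pi_2|_{\Gamma_j}$ at $(w,z)$. Suppose that $F$ is ergodic with respect to $\mu$: every Borel set $C$ for which there is a Borel set $C'\subseteq C$ with $\mu(C')=\mu(C)$ and $F^{\dagger}(C')\subseteq C$ satisfies $\mu(C)=0$ or $\mu(C)=1$. Let $A,B\subseteq X$ be Borel sets for which $\lim_{n\to\infty}\frac1n\sum_{j=0}^{n-1}\mu(F^j(A)\cap B)$ exists. Then $$\lim_{n\to\infty}\frac1n\sum_{j=0}^{n-1}\mu(F^j(A)\cap B)\ \ge\ \mu(A)\,\mu(B).$$ -/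

import Mathlib

open MeasureTheory Filter Set
open scoped Manifold ContDiff Topology

/-! ### Complex subvarieties of a complex manifold -/

/-- `S` is a (closed) complex analytic subset of the complex manifold `M`: near every point of `M`
it is the common zero set of finitely many holomorphic functions. -/
def IsAnalyticSubset {E H M : Type*} [NormedAddCommGroup E] [NormedSpace ℂ E] [TopologicalSpace H]
    (I : ModelWithCorners ℂ E H) [TopologicalSpace M] [ChartedSpace H M] (S : Set M) : Prop :=
  ∀ p : M, ∃ U : Set M, IsOpen U ∧ p ∈ U ∧ ∃ (n : ℕ) (f : Fin n → M → ℂ),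
    (∀ i, MDifferentiableOn I 𝓘(ℂ, ℂ) (f i) U) ∧ S ∩ U = {x | x ∈ U ∧ ∀ i, f i x = 0}

/-- An irreducible complex subvariety: a nonempty analytic subset that is not the union of two
analytic subsets both different from it. -/
def IsIrreducibleSubvariety {E H M : Type*} [NormedAddCommGroup E] [NormedSpace ℂ E]
    [TopologicalSpace H] (I : ModelWithCorners ℂ E H) [TopologicalSpace M] [ChartedSpace H M]
    (S : Set M) : Prop :=
  IsAnalyticSubset I S ∧ S.Nonempty ∧
    ∀ A B : Set M, IsAnalyticSubset I A → IsAnalyticSubset I B → S = A ∪ B → S = A ∨ S = B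

/-- `p` is a regular point of `S` of dimension `r`: near `p`, the set `S` is the zero set of a
holomorphic map with values in `ℂ ^ c`, submersive at `p`, where `r + c` is the dimension of the
ambient manifold. Thus `S` is an `r`-dimensional complex submanifold near `p`. -/
def IsRegularPointOfDim {E H M : Type*} [NormedAddCommGroup E] [NormedSpace ℂ E]
    [TopologicalSpace H] (I : ModelWithCorners ℂ E H) [TopologicalSpace M] [ChartedSpace H M]
    (S : Set M) (r : ℕ) (p : M) : Prop :=
  p ∈ S ∧ ∃ U : Set M, IsOpen U ∧ p ∈ U ∧
    ∃ (c : ℕ) (f : M → EuclideanSpace ℂ (Fin c)), Module.finrank ℂ E = r + c ∧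
      MDifferentiableOn I 𝓘(ℂ, EuclideanSpace ℂ (Fin c)) f U ∧
      Function.Surjective (mfderiv I 𝓘(ℂ, EuclideanSpace ℂ (Fin c)) f p) ∧
      S ∩ U = {x | x ∈ U ∧ f x = 0}

/-- The dimension of an analytic subset: the largest dimension of its regular points. -/
noncomputable def analyticDim {E H M : Type*} [NormedAddCommGroup E] [NormedSpace ℂ E]
    [TopologicalSpace H] (I : ModelWithCorners ℂ E H) [TopologicalSpace M] [ChartedSpace H M]
    (S : Set M) : ℕ :=
  sSup {r : ℕ | ∃ p : M, IsRegularPointOfDim I S r p}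

/-! ### Generic points and multiplicities -/

/-- `P` holds at generic points of `X`: on a dense open subset. -/
def HoldsGenerically {X : Type*} [TopologicalSpace X] (P : X → Prop) : Prop :=
  ∃ O : Set X, IsOpen O ∧ Dense O ∧ ∀ z ∈ O, P z

/-- The multiplicity of `p ∈ Γ` in the fibre of the second projection `Γ → X` through `p` (the
local degree of this projection at `p`): the number of preimages, in a sufficiently small
neighbourhood of `p`, of a generic point of `X` close to `p.2`. Shrinking the neighbourhood `U`
decreases the generic number of preimages in `U`, so the multiplicity is the least generic bound
over all `U`; the point `p` itself always counts at least once. -/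
noncomputable def localMultiplicity {X : Type*} [TopologicalSpace X] (Γ : Set (X × X))
    (p : X × X) : ℕ :=
  max 1 (sInf {m : ℕ | ∃ U ∈ 𝓝 p,
    HoldsGenerically fun z : X => {q : X × X | q ∈ Γ ∧ q ∈ U ∧ q.2 = z}.encard ≤ (m : ℕ∞)})

/-! ### Holomorphic correspondences -/

/-- A holomorphic correspondence `∑ j, mult j • Γ j` on a complex manifold `X` of dimension `k`. -/
structure HolomorphicCorrespondence (k : ℕ) (X : Type*) [TopologicalSpace X]
    [ChartedSpace (EuclideanSpace ℂ (Fin k)) X] where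
  /-- the number of components -/
  N : ℕ
  N_pos : 0 < N
  /-- the multiplicities of the components -/
  mult : Fin N → ℕ
  mult_pos : ∀ j, 0 < mult j
  /-- the components -/
  Γ : Fin N → Set (X × X)
  distinct : Function.Injective Γ
  irreducible : ∀ j, IsIrreducibleSubvariety
    (𝓘(ℂ, EuclideanSpace ℂ (Fin k)).prod 𝓘(ℂ, EuclideanSpace ℂ (Fin k))) (Γ j)
  dim_eq : ∀ j, analyticDim
    (𝓘(ℂ, EuclideanSpace ℂ (Fin k)).prod 𝓘(ℂ, EuclideanSpace ℂ (Fin k))) (Γ j) = k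
  surj_fst : ∀ j, Prod.fst '' Γ j = univ
  surj_snd : ∀ j, Prod.snd '' Γ j = univ
  finite_image : ∀ j (z : X), {w : X | (z, w) ∈ Γ j}.Finite
  finite_preimage : ∀ j (z : X), {w : X | (w, z) ∈ Γ j}.Finite

namespace HolomorphicCorrespondence

variable {k : ℕ} {X : Type*} [TopologicalSpace X] [ChartedSpace (EuclideanSpace ℂ (Fin k)) X]

/-- The support `|Γ|` of the correspondence. -/
def support (F : HolomorphicCorrespondence k X) : Set (X × X) := ⋃ j, F.Γ j

/-- The image `F(A) = π₂(π₁⁻¹(A) ∩ |Γ|)`; the iterate `Fⁿ(A)` is `F.image^[n] A`. -/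
def image (F : HolomorphicCorrespondence k X) (A : Set X) : Set X :=
  Prod.snd '' (Prod.fst ⁻¹' A ∩ F.support)

/-- The preimage `F†(A) = π₁(π₂⁻¹(A) ∩ |Γ|)`. -/
def preimage (F : HolomorphicCorrespondence k X) (A : Set X) : Set X :=
  Prod.fst '' (Prod.snd ⁻¹' A ∩ F.support)

/-- The topological degree `d` of `F`: the cardinality of `F†(z)`, the components being counted
with their multiplicities, for generic `z`. (The set below has at most one element.) -/
noncomputable def topDegree (F : HolomorphicCorrespondence k X) : ℕ :=
  sInf {d : ℕ | HoldsGenerically fun z : X => ∑ j, F.mult j * {w : X | (w, z) ∈ F.Γ j}.ncard = d}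

/-- The sum of `φ w` over `w ∈ F†(z)`, the points being repeated according to multiplicity. -/
noncomputable def preimageSum (F : HolomorphicCorrespondence k X) (φ : X → ℝ) (z : X) : ℝ :=
  ∑ j, (F.mult j : ℝ) *
    ∑ᶠ w ∈ {w : X | (w, z) ∈ F.Γ j}, (localMultiplicity (F.Γ j) (w, z) : ℝ) * φ w

variable [MeasurableSpace X]

/-- `μ` is `F*`-invariant: `F* μ = d μ`, as functionals on the continuous functions, where
`⟨F* μ, φ⟩` is the integral of the sum of `φ` over the preimages. -/
def IsPullbackInvariant (F : HolomorphicCorrespondence k X) (μ : Measure X) : Prop :=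
  ∀ φ : C(X, ℝ), Integrable (F.preimageSum φ) μ ∧
    ∫ z, F.preimageSum φ z ∂μ = (F.topDegree : ℝ) * ∫ z, φ z ∂μ

/-- The Borel set `B` is almost invariant with respect to `F` and `μ`. -/
def AlmostInvariant (F : HolomorphicCorrespondence k X) (μ : Measure X) (B : Set X) : Prop :=
  ∃ B' : Set X, MeasurableSet B' ∧ B' ⊆ B ∧ μ B = μ B' ∧ F.preimage B' ⊆ B

/-- `F` is ergodic with respect to the (invariant) measure `μ`. -/
def IsErgodic (F : HolomorphicCorrespondence k X) (μ : Measure X) : Prop :=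
  ∀ B : Set X, MeasurableSet B → F.AlmostInvariant μ B → μ B = 0 ∨ μ B = 1

end HolomorphicCorrespondence

/-! ### Measurability of families of measures -/

/-! Normalize the pullback to the averaging operator `P φ(z) = d⁻¹ ∑' φ(w)` over `w ∈ F†(z)`, that
is, integration against `preimageMeasure z`. Invariance says that `μ` is stationary for `P`, and
ergodicity says that the fixed vectors of `P` in `L²(μ)` are constant. Von Neumann's mean ergodic
theorem then makes the Cesàro means of `∫_B P^j 1_A dμ` converge to `μ(A) μ(B)`
(`tendsto_cesaro_setIntegral_kernel`). Since `P^j 1_A` takes values in `[0,1]` and vanishes off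
`F^j(A)`, each term is at most `μ(F^j(A) ∩ B)`, and the inequality passes to the limit.

Two points need care. The measure `preimageMeasure z` has mass at least `1` for every `z`, by
semicontinuity of the number of preimages (`topDegree_le_preimageSum_one`), and mean mass `1` by
invariance applied to the constant `1`; so its mass is `1` almost everywhere, and no exact count
with multiplicity at special points is needed. Its dependence on `z` is only almost everywhere
measurable, so it is replaced by a true kernel that vanishes on a null set (`exists_kernel`). -/

theorem aemeasurable_measure_of_forall_measurableSet {α β : Type*} [MeasurableSpace α]
    [MeasurableSpace β] [MeasurableSpace.CountablyGenerated β] {μ : Measure α} {κ : α → Measure β}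
    [∀ a, IsFiniteMeasure (κ a)]
    (h : ∀ s, MeasurableSet s → AEMeasurable (fun a => κ a s) μ) : AEMeasurable κ μ := by
  classical
  -- A countable generating π-system: the exceptional null sets for its members unite to one null
  -- set, off which `κ` is determined by measurable data.
  set S : Set (Set β) := generateSetAlgebra (MeasurableSpace.countableGeneratingSet β) with hS
  have hSc : S.Countable :=
    countable_generateSetAlgebra (MeasurableSpace.countable_countableGeneratingSet)
  have hSg : ‹MeasurableSpace β› = MeasurableSpace.generateFrom S := by
    rw [hS, generateFrom_generateSetAlgebra_eq,
      MeasurableSpace.generateFrom_countableGeneratingSet]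
  have hSm : ∀ s ∈ S, MeasurableSet s := fun s hs => by
    rw [hSg]; exact MeasurableSpace.measurableSet_generateFrom hs
  have hpi : IsPiSystem S := fun s hs t ht _ =>
    isSetAlgebra_generateSetAlgebra.inter_mem hs ht
  have huniv : univ ∈ S := isSetAlgebra_generateSetAlgebra.univ_mem
  have hae : ∀ᵐ a ∂μ, ∀ s (hs : s ∈ S), κ a s = (h s (hSm s hs)).mk _ a := by
    rw [ae_ball_iff hSc]
    exact fun s hs => (h s (hSm s hs)).ae_eq_mk
  set N := toMeasurable μ {a | ¬ ∀ s (hs : s ∈ S), κ a s = (h s (hSm s hs)).mk _ a} with hN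
  have hNm : MeasurableSet N := measurableSet_toMeasurable _ _
  have hN0 : μ N = 0 := by rw [hN, measure_toMeasurable]; exact hae
  have hNe : ∀ a ∉ N, ∀ s (hs : s ∈ S), κ a s = (h s (hSm s hs)).mk _ a := fun a ha => by
    by_contra hc
    exact ha (subset_toMeasurable _ _ hc)
  refine ⟨N.piecewise (fun _ => 0) κ, ?_, ?_⟩
  · have : ∀ a, IsFiniteMeasure (N.piecewise (fun _ => (0 : Measure β)) κ a) := fun a => by
      by_cases ha : a ∈ N <;> simp only [piecewise, ha, if_true, if_false] <;> infer_instance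
    have key : ∀ s (hs : s ∈ S),
        Measurable fun a => N.piecewise (fun _ => (0 : Measure β)) κ a s := fun s hs => by
      have : (fun a => N.piecewise (fun _ => (0 : Measure β)) κ a s)
          = N.piecewise (fun _ => 0) ((h s (hSm s hs)).mk _) := by
        ext a
        by_cases ha : a ∈ N
        · simp [ha]
        · simp only [piecewise, ha, if_false]
          exact hNe a ha s hs
      rw [this]
      exact Measurable.piecewise hNm measurable_const (h s (hSm s hs)).measurable_mk
    exact Measurable.measure_of_isPiSystem hSg hpi key (key _ huniv)
  · filter_upwards [measure_eq_zero_iff_ae_notMem.1 hN0] with a ha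
    simp [piecewise, ha]

open scoped BoundedContinuousFunction in
-- Indicators of closed sets are limits of continuous functions, and closed sets form a π-system
-- generating the Borel sets. Test functions suffice because invariance speaks only of these.
theorem aemeasurable_measure_of_forall_integral {α β : Type*} [MeasurableSpace α]
    [TopologicalSpace β] [MeasurableSpace β] [BorelSpace β] [HasOuterApproxClosed β]
    [MeasurableSpace.CountablyGenerated β] {μ : Measure α} {κ : α → Measure β}
    [∀ a, IsFiniteMeasure (κ a)]
    (h : ∀ f : β →ᵇ ℝ, AEMeasurable (fun a => ∫ x, f x ∂κ a) μ) : AEMeasurable κ μ := by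
  have huniv : AEMeasurable (fun a => κ a univ) μ := by
    have := (h (BoundedContinuousFunction.const β 1)).ennreal_ofReal
    simpa using this
  refine aemeasurable_measure_of_forall_measurableSet fun s hs => ?_
  induction s, hs using MeasurableSpace.induction_on_inter
    ((BorelSpace.measurable_eq (α := β)).trans borel_eq_generateFrom_isClosed)
    isPiSystem_isClosed with
  | empty => simp
  | basic s hs =>
    have hlim := fun a => HasOuterApproxClosed.tendsto_lintegral_apprSeq hs (κ a)
    refine aemeasurable_of_tendsto_metrizable_ae atTop (fun n => ?_) (ae_of_all _ hlim)
    set g : β →ᵇ ℝ := ⟨⟨fun x => (IsClosed.apprSeq hs n x : ℝ),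
      NNReal.continuous_coe.comp (IsClosed.apprSeq hs n).continuous⟩,
      (IsClosed.apprSeq hs n).map_bounded'⟩ with hg
    refine (h g).ennreal_ofReal.congr (ae_of_all _ fun a => ?_)
    dsimp only
    rw [ofReal_integral_eq_lintegral_ofReal (g.integrable _)
      (ae_of_all _ fun x => NNReal.coe_nonneg _)]
    exact lintegral_congr fun x => ENNReal.ofReal_coe_nnreal
  | compl s hs ih =>
    have : (fun a => κ a sᶜ) = fun a => κ a univ - κ a s := by
      ext a; exact measure_compl hs (measure_ne_top _ _)
    rw [this]
    exact huniv.sub ih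
  | iUnion f hd hm ih =>
    have : (fun a => κ a (⋃ i, f i)) = fun a => ∑' i, κ a (f i) := by
      ext a; exact measure_iUnion hd hm
    rw [this]
    exact AEMeasurable.tsum ih

/-! ### The mean ergodic theorem for kernels -/

open ProbabilityTheory in
theorem measurePreserving_fst_compProd {X Y : Type*} [MeasurableSpace X] [MeasurableSpace Y]
    {μ : Measure X} [SFinite μ] {κ : Kernel X Y} [IsSFiniteKernel κ]
    (h1 : ∀ᵐ z ∂μ, κ z univ = 1) : MeasurePreserving Prod.fst (μ ⊗ₘ κ) μ := by
  refine ⟨measurable_fst, ?_⟩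
  ext s hs
  rw [Measure.map_apply measurable_fst hs, ← prod_univ,
    Measure.compProd_apply_prod hs MeasurableSet.univ,
    lintegral_congr_ae (ae_restrict_of_ae h1)]
  simp

open ProbabilityTheory in
theorem measurePreserving_snd_compProd {X : Type*} [MeasurableSpace X]
    {μ : Measure X} [SFinite μ] {κ : Kernel X X} [IsSFiniteKernel κ]
    (hinv : μ.bind κ = μ) : MeasurePreserving Prod.snd (μ ⊗ₘ κ) μ := by
  refine ⟨measurable_snd, ?_⟩
  ext s hs
  rw [Measure.map_apply measurable_snd hs, ← univ_prod,
    Measure.compProd_apply_prod MeasurableSet.univ hs]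
  conv_rhs => rw [← hinv, Measure.bind_apply hs κ.aemeasurable]
  simp

/-- The operator on `L²` associated with a coupling `ν` of two copies of `μ`. -/
noncomputable def couplingOperator {X : Type*} [MeasurableSpace X] {μ : Measure X}
    {ν : Measure (X × X)} (h₁ : MeasurePreserving Prod.fst ν μ)
    (h₂ : MeasurePreserving Prod.snd ν μ) : Lp ℝ 2 μ →L[ℝ] Lp ℝ 2 μ :=
  (ContinuousLinearMap.adjoint
    (Lp.compMeasurePreservingₗᵢ ℝ Prod.fst h₁ (p := 2) (E := ℝ)).toContinuousLinearMap).comp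
    (Lp.compMeasurePreservingₗᵢ ℝ Prod.snd h₂ (p := 2) (E := ℝ)).toContinuousLinearMap

section couplingOperator

variable {X : Type*} [MeasurableSpace X] {μ : Measure X} {ν : Measure (X × X)}
  (h₁ : MeasurePreserving Prod.fst ν μ) (h₂ : MeasurePreserving Prod.snd ν μ)

theorem inner_couplingOperator (f g : Lp ℝ 2 μ) :
    inner ℝ g (couplingOperator h₁ h₂ f) =
      inner ℝ (Lp.compMeasurePreservingₗᵢ ℝ Prod.fst h₁ (p := 2) (E := ℝ) g)
        (Lp.compMeasurePreservingₗᵢ ℝ Prod.snd h₂ (p := 2) (E := ℝ) f) := by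
  rw [couplingOperator, ContinuousLinearMap.comp_apply, ContinuousLinearMap.adjoint_inner_right]
  rfl

theorem norm_couplingOperator_le : ‖couplingOperator h₁ h₂‖ ≤ 1 := by
  refine (ContinuousLinearMap.opNorm_comp_le _ _).trans ?_
  rw [LinearIsometryEquiv.norm_map]
  exact mul_le_one₀ (LinearIsometry.norm_toContinuousLinearMap_le _) (norm_nonneg _)
    (LinearIsometry.norm_toContinuousLinearMap_le _)

/-- Equality case of Cauchy–Schwarz: the two pullbacks of `f` to the coupling have the same norm as
`f`, and for a fixed vector their inner product is `‖f‖ ^ 2`, so they coincide. -/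
theorem ae_eq_of_couplingOperator_eq_self {f : Lp ℝ 2 μ} (hf : couplingOperator h₁ h₂ f = f) :
    ∀ᵐ p ∂ν, f p.2 = f p.1 := by
  set J₁ := Lp.compMeasurePreservingₗᵢ ℝ Prod.fst h₁ (p := 2) (E := ℝ)
  set J₂ := Lp.compMeasurePreservingₗᵢ ℝ Prod.snd h₂ (p := 2) (E := ℝ)
  have hin : inner ℝ (J₁ f) (J₂ f) = ‖f‖ ^ 2 := by
    rw [← inner_couplingOperator, hf, real_inner_self_eq_norm_sq]
  have hJ : J₁ f = J₂ f := by
    have : ‖J₁ f - J₂ f‖ ^ 2 = 0 := by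
      rw [norm_sub_sq_real, hin, LinearIsometry.norm_map, LinearIsometry.norm_map]; ring
    exact sub_eq_zero.1 (norm_eq_zero.1 (pow_eq_zero_iff two_ne_zero |>.1 this))
  have e1 := Lp.coeFn_compMeasurePreserving f h₁
  have e2 := Lp.coeFn_compMeasurePreserving f h₂
  have hJ' : Lp.compMeasurePreserving Prod.fst h₁ f = Lp.compMeasurePreserving Prod.snd h₂ f := hJ
  rw [hJ'] at e1
  filter_upwards [e1, e2] with p h h'
  exact h'.symm.trans h

theorem couplingOperator_apply_indicatorConst_univ [IsFiniteMeasure μ] [IsFiniteMeasure ν] :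
    couplingOperator h₁ h₂ (indicatorConstLp 2 MeasurableSet.univ (measure_ne_top μ _) 1) =
      indicatorConstLp 2 MeasurableSet.univ (measure_ne_top μ _) 1 := by
  refine ext_inner_left ℝ fun g => ?_
  rw [inner_couplingOperator, ← LinearIsometry.inner_map_map
    (Lp.compMeasurePreservingₗᵢ ℝ Prod.fst h₁ (p := 2) (E := ℝ)) g]
  -- Both pullbacks send the constant `1` to the constant `1`.
  congr 1

open ProbabilityTheory in
-- Disintegrating the inner product on `μ ⊗ₘ κ` over the first coordinate identifies the abstract
-- operator with integration against `κ`.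
theorem couplingOperator_compProd_toLp [IsFiniteMeasure μ] {κ : Kernel X X} [IsFiniteKernel κ]
    (h₁ : MeasurePreserving Prod.fst (μ ⊗ₘ κ) μ) (h₂ : MeasurePreserving Prod.snd (μ ⊗ₘ κ) μ)
    {u : X → ℝ} (hu : MemLp u 2 μ) (hPu : MemLp (fun z => ∫ w, u w ∂κ z) 2 μ) :
    couplingOperator h₁ h₂ (hu.toLp u) = hPu.toLp _ := by
  refine ext_inner_left ℝ fun g => ?_
  rw [inner_couplingOperator, L2.inner_def, L2.inner_def]
  have hg : MemLp g 2 μ := Lp.memLp g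
  have e1 := Lp.coeFn_compMeasurePreserving g h₁
  have e2 : (Lp.compMeasurePreserving Prod.snd h₂ (hu.toLp u) : X × X → ℝ) =ᵐ[μ ⊗ₘ κ]
      fun p => u p.2 := by
    rw [Lp.toLp_compMeasurePreserving]
    exact MemLp.coeFn_toLp _
  have hint : Integrable (fun p : X × X => u p.2 * g p.1) (μ ⊗ₘ κ) :=
    (hu.comp_measurePreserving h₂).integrable_mul (hg.comp_measurePreserving h₁)
  calc _ = ∫ p : X × X, u p.2 * g p.1 ∂(μ ⊗ₘ κ) := by
        refine integral_congr_ae ?_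
        filter_upwards [e1, e2] with p h h'
        change inner ℝ (Lp.compMeasurePreserving Prod.fst h₁ g p)
          (Lp.compMeasurePreserving Prod.snd h₂ (hu.toLp u) p) = _
        rw [h, h']; rfl
    _ = ∫ z, ∫ w, u w * g z ∂κ z ∂μ := Measure.integral_compProd hint
    _ = _ := by
        refine integral_congr_ae ?_
        filter_upwards [hPu.coeFn_toLp] with z hz
        rw [hz, integral_mul_const]; rfl

end couplingOperator

open ProbabilityTheory in
theorem stronglyMeasurable_and_mem_Icc_of_kernel_iterate {X : Type*} [MeasurableSpace X]
    {κ : Kernel X X} (hle : ∀ z, κ z univ ≤ 1)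
    {u : ℕ → X → ℝ} (hu : Measurable (u 0)) (hu0 : ∀ z, u 0 z ∈ Icc (0 : ℝ) 1)
    (husucc : ∀ j z, u (j + 1) z = ∫ w, u j w ∂κ z) (j : ℕ) :
    StronglyMeasurable (u j) ∧ ∀ z, u j z ∈ Icc (0 : ℝ) 1 := by
  have : IsFiniteKernel κ := ⟨1, ENNReal.one_lt_top, hle⟩
  induction j with
  | zero => exact ⟨hu.stronglyMeasurable, hu0⟩
  | succ j ih =>
    have e : u (j + 1) = fun z => ∫ w, u j w ∂κ z := funext (husucc j)
    refine ⟨by rw [e]; exact ih.1.integral_kernel, fun z => ?_⟩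
    rw [husucc]
    refine ⟨integral_nonneg fun w => (ih.2 w).1, ?_⟩
    calc ∫ w, u j w ∂κ z ≤ ∫ w, 1 ∂κ z := by
          refine integral_mono_of_nonneg (ae_of_all _ fun w => (ih.2 w).1)
            (integrable_const _) (ae_of_all _ fun w => (ih.2 w).2)
      _ = (κ z).real univ := by simp
      _ ≤ 1 := ENNReal.toReal_le_of_le_ofReal zero_le_one (by simpa using hle z)

open ProbabilityTheory in
theorem tendsto_cesaro_setIntegral_kernel {X : Type*} [MeasurableSpace X] {μ : Measure X}
    [IsProbabilityMeasure μ] {κ : Kernel X X} (hle : ∀ z, κ z univ ≤ 1)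
    (h1 : ∀ᵐ z ∂μ, κ z univ = 1) (hinv : μ.bind κ = μ)
    (herg : ∀ C, MeasurableSet C → (∀ᵐ z ∂μ, z ∈ C → ∀ᵐ w ∂κ z, w ∈ C) → μ C = 0 ∨ μ C = 1)
    {u : ℕ → X → ℝ} (hu : Measurable (u 0)) (hu0 : ∀ z, u 0 z ∈ Icc (0 : ℝ) 1)
    (husucc : ∀ j z, u (j + 1) z = ∫ w, u j w ∂κ z) {B : Set X} (hB : MeasurableSet B) :
    Tendsto (fun n : ℕ => (1 / (n : ℝ)) * ∑ j ∈ Finset.range n, ∫ z in B, u j z ∂μ) atTop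
      (𝓝 ((∫ z, u 0 z ∂μ) * μ.real B)) := by
  have : IsFiniteKernel κ := ⟨1, ENNReal.one_lt_top, hle⟩
  have hprop := stronglyMeasurable_and_mem_Icc_of_kernel_iterate hle hu hu0 husucc
  have hmem : ∀ j, MemLp (u j) 2 μ := fun j =>
    MemLp.of_bound (hprop j).1.aestronglyMeasurable 1 (ae_of_all _ fun z => by
      rw [Real.norm_eq_abs, abs_of_nonneg ((hprop j).2 z).1]; exact ((hprop j).2 z).2)
  have h₁ : MeasurePreserving Prod.fst (μ ⊗ₘ κ) μ := measurePreserving_fst_compProd h1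
  have h₂ : MeasurePreserving Prod.snd (μ ⊗ₘ κ) μ := measurePreserving_snd_compProd hinv
  set T := couplingOperator h₁ h₂ with hT
  have hiter : ∀ j, T^[j] ((hmem 0).toLp _) = (hmem j).toLp _ := fun j => by
    induction j with
    | zero => rfl
    | succ j ih =>
      rw [Function.iterate_succ_apply', ih]
      have e : u (j + 1) = fun z => ∫ w, u j w ∂κ z := funext (husucc j)
      rw [hT, couplingOperator_compProd_toLp h₁ h₂ (hmem j) (e ▸ hmem (j + 1))]
      congr 1
      exact e.symm
  set one : Lp ℝ 2 μ := indicatorConstLp 2 MeasurableSet.univ (measure_ne_top μ _) 1 with hone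
  set K := T.eqLocus (1 : Lp ℝ 2 μ →L[ℝ] Lp ℝ 2 μ) with hK
  have hone_mem : one ∈ K := couplingOperator_apply_indicatorConst_univ h₁ h₂
  -- A fixed `g` satisfies `g w = g z` for `κ z`-almost every `w`, so each `g ⁻¹' U` is invariant
  -- and has measure `0` or `1`; as `ℝ` is countably separated, `g` is almost everywhere constant.
  have hconst : ∀ g ∈ K, ∃ c : ℝ, g = c • one := fun g hg => by
    have hge := Measure.ae_ae_of_ae_compProd (ae_eq_of_couplingOperator_eq_self h₁ h₂ hg)
    have hgm : Measurable g := (Lp.stronglyMeasurable g).measurable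
    obtain ⟨c, hc⟩ := exists_eventuallyEq_const_of_forall_separating (l := ae μ) (f := g)
      MeasurableSet fun U hU => by
        have := herg (g ⁻¹' U) (hgm hU) (by
          filter_upwards [hge] with z hz hzU
          filter_upwards [hz] with w hw
          simpa [hw] using hzU)
        rcases this with h | h
        · exact Or.inr (measure_eq_zero_iff_ae_notMem.1 h)
        · exact Or.inl ((prob_compl_eq_zero_iff (hgm hU)).2 h)
    refine ⟨c, Lp.ext ?_⟩
    filter_upwards [hc, Lp.coeFn_smul c one, indicatorConstLp_coeFn (μ := μ) (p := 2)
      (hs := MeasurableSet.univ) (hμs := measure_ne_top μ _) (c := (1 : ℝ))] with z h h' h''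
    rw [h, h', Pi.smul_apply, hone, h'']
    simp
  set f := (hmem 0).toLp _ with hf
  obtain ⟨c, hc⟩ := hconst (K.orthogonalProjectionOnto f) (Subtype.mem _)
  have hinner_one : ∀ g : Lp ℝ 2 μ, inner ℝ one g = ∫ z, g z ∂μ := fun g => by
    rw [hone, L2.inner_indicatorConstLp_one, setIntegral_univ]
  -- The constant is found by pairing with `one`, which lies in `K` and so does not see the
  -- projection.
  have hcval : c = ∫ z, u 0 z ∂μ := by
    have e1 : inner ℝ one (K.orthogonalProjectionOnto f : Lp ℝ 2 μ) = inner ℝ one f :=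
      K.inner_orthogonalProjectionOnto_eq_of_mem_left ⟨one, hone_mem⟩ f
    rw [hc, inner_smul_right, hinner_one, hinner_one f, integral_congr_ae (hmem 0).coeFn_toLp,
      integral_congr_ae (indicatorConstLp_coeFn (μ := μ) (p := 2)
      (hs := MeasurableSet.univ) (hμs := measure_ne_top μ _) (c := (1 : ℝ)))] at e1
    simpa using e1
  have hlim := T.tendsto_birkhoffAverage_orthogonalProjection (norm_couplingOperator_le h₁ h₂) f
  set b : Lp ℝ 2 μ := indicatorConstLp 2 hB (measure_ne_top μ _) 1 with hb
  have hlim2 := (Filter.Tendsto.inner (𝕜 := ℝ) (tendsto_const_nhds (x := b)) hlim)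
  have hinner_b : ∀ g : Lp ℝ 2 μ, inner ℝ b g = ∫ z in B, g z ∂μ := fun g => by
    rw [hb, L2.inner_indicatorConstLp_one]
  have hval : inner ℝ b ((K.orthogonalProjectionOnto f : Lp ℝ 2 μ)) =
      (∫ z, u 0 z ∂μ) * μ.real B := by
    rw [hc, inner_smul_right, hcval, hinner_b, setIntegral_congr_ae hB
      ((indicatorConstLp_coeFn (μ := μ) (p := 2) (hs := MeasurableSet.univ)
      (hμs := measure_ne_top μ _) (c := (1 : ℝ))).mono fun z hz _ => hz)]
    simp
  rw [← hval]
  refine hlim2.congr fun n => ?_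
  rw [birkhoffAverage, birkhoffSum, inner_smul_right, inner_sum, one_div]
  congr 1
  refine Finset.sum_congr rfl fun j _ => ?_
  rw [id, hiter, hinner_b]
  exact setIntegral_congr_ae hB ((hmem j).coeFn_toLp.mono fun z hz _ => hz)

/-! ### Topology of correspondences -/

theorem IsAnalyticSubset.isClosed {E H M : Type*} [NormedAddCommGroup E] [NormedSpace ℂ E]
    [TopologicalSpace H] {I : ModelWithCorners ℂ E H} [TopologicalSpace M] [ChartedSpace H M]
    {S : Set M} (hS : IsAnalyticSubset I S) : IsClosed S := by
  rw [← isOpen_compl_iff, isOpen_iff_mem_nhds]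
  intro p hp
  obtain ⟨U, hU, hpU, n, f, hf, hSU⟩ := hS p
  have hpi : ∃ i, f i p ≠ 0 := by
    by_contra! hc
    exact hp ((hSU ▸ (⟨hpU, hc⟩ : p ∈ {x | x ∈ U ∧ ∀ i, f i x = 0}) : p ∈ S ∩ U).1)
  obtain ⟨i, hi⟩ := hpi
  have hUp : U ∈ 𝓝 p := hU.mem_nhds hpU
  filter_upwards [hUp, ((hf i).continuousOn.continuousAt hUp).eventually_ne hi] with x hxU hx hxS
  have : x ∈ {x | x ∈ U ∧ ∀ i, f i x = 0} := hSU ▸ ⟨hxS, hxU⟩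
  exact hx (this.2 i)

theorem HoldsGenerically.mono {X : Type*} [TopologicalSpace X] {P Q : X → Prop}
    (h : HoldsGenerically P) (hPQ : ∀ z, P z → Q z) : HoldsGenerically Q := by
  obtain ⟨O, hO, hd, hP⟩ := h
  exact ⟨O, hO, hd, fun z hz => hPQ z (hP z hz)⟩

theorem HoldsGenerically.and {X : Type*} [TopologicalSpace X] {P Q : X → Prop}
    (hP : HoldsGenerically P) (hQ : HoldsGenerically Q) : HoldsGenerically fun z => P z ∧ Q z := by
  obtain ⟨O, hO, hd, hP⟩ := hP
  obtain ⟨O', hO', hd', hQ⟩ := hQ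
  exact ⟨O ∩ O', hO.inter hO', hd.inter_of_isOpen_left hd' hO, fun z hz => ⟨hP z hz.1, hQ z hz.2⟩⟩

theorem HoldsGenerically.finset_forall {X ι : Type*} [TopologicalSpace X] (s : Finset ι)
    {P : ι → X → Prop} (hP : ∀ i ∈ s, HoldsGenerically (P i)) :
    HoldsGenerically fun z => ∀ i ∈ s, P i z := by
  classical
  induction s using Finset.induction_on with
  | empty => exact ⟨univ, isOpen_univ, dense_univ, by simp⟩
  | insert i s _ ih =>
    refine ((hP i (Finset.mem_insert_self _ _)).and
      (ih fun j hj => hP j (Finset.mem_insert_of_mem hj))).mono fun z hz => ?_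
    simpa using hz

theorem HoldsGenerically.exists_of_eventually {X : Type*} [TopologicalSpace X] {P Q : X → Prop}
    {z : X} (hP : HoldsGenerically P) (hQ : ∀ᶠ x in 𝓝 z, Q x) : ∃ x, P x ∧ Q x := by
  obtain ⟨O, hO, hd, hP⟩ := hP
  obtain ⟨x, hx, hxO⟩ := mem_closure_iff_nhds.1 (hd z) _ hQ
  exact ⟨x, hP x hxO, hx⟩

/-- If the fibres of the second projection of `Γ` have generically bounded cardinality, then the
generic number of points of a fibre near `p` is at most the multiplicity of `p`. -/
theorem exists_nhds_holdsGenerically_encard_le_localMultiplicity {X : Type*} [TopologicalSpace X]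
    {Γ : Set (X × X)} {d : ℕ}
    (hd : HoldsGenerically fun z : X => {w : X | (w, z) ∈ Γ}.encard ≤ (d : ℕ∞)) (p : X × X) :
    ∃ U ∈ 𝓝 p, HoldsGenerically fun z : X =>
      {w : X | (w, z) ∈ Γ ∧ (w, z) ∈ U}.encard ≤ (localMultiplicity Γ p : ℕ∞) := by
  have key : ∀ (U : Set (X × X)) (z : X), {q : X × X | q ∈ Γ ∧ q ∈ U ∧ q.2 = z}.encard =
      {w : X | (w, z) ∈ Γ ∧ (w, z) ∈ U}.encard := fun U z => by
    refine Eq.trans (congrArg encard (Set.ext fun ⟨a, b⟩ => ?_))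
      ((Prod.mk_left_injective z).encard_image {w : X | (w, z) ∈ Γ ∧ (w, z) ∈ U})
    constructor
    · rintro ⟨h, h', rfl⟩
      exact ⟨a, ⟨h, h'⟩, rfl⟩
    · rintro ⟨w, ⟨h, h'⟩, e⟩
      obtain ⟨rfl, rfl⟩ := Prod.mk.inj e
      exact ⟨h, h', rfl⟩
  have hne : {m : ℕ | ∃ U ∈ 𝓝 p, HoldsGenerically fun z : X =>
      {q : X × X | q ∈ Γ ∧ q ∈ U ∧ q.2 = z}.encard ≤ (m : ℕ∞)}.Nonempty :=
    ⟨d, univ, univ_mem, hd.mono fun z hz => by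
      rw [key]; simpa using hz⟩
  obtain ⟨U, hU, h⟩ := Nat.sInf_mem hne
  refine ⟨U, hU, h.mono fun z hz => ?_⟩
  rw [← key]
  exact hz.trans (Nat.cast_le.2 (le_max_right _ _))

/-- Projection along a compact factor is closed, so the part of `Γ` outside the interior of `U` has
closed image, and this image misses `z`. -/
theorem eventually_fibre_subset {X Y : Type*} [TopologicalSpace X] [TopologicalSpace Y]
    [CompactSpace X] {Γ : Set (X × Y)} (hΓ : IsClosed Γ) {z : Y} {U : Set (X × Y)}
    (hU : ∀ w, (w, z) ∈ Γ → U ∈ 𝓝 (w, z)) : ∀ᶠ y in 𝓝 z, ∀ w, (w, y) ∈ Γ → (w, y) ∈ U := by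
  have hc : IsClosed (Prod.snd '' (Γ \ interior U)) :=
    isClosedMap_snd_of_compactSpace _ (hΓ.sdiff isOpen_interior)
  have hz : z ∉ Prod.snd '' (Γ \ interior U) := by
    rintro ⟨⟨w, y⟩, ⟨h, h'⟩, rfl⟩
    exact h' (mem_interior_iff_mem_nhds.2 (hU w h))
  filter_upwards [hc.isOpen_compl.mem_nhds hz] with y hy w hw
  by_contra hn
  exact hy ⟨(w, y), ⟨hw, fun h => hn (interior_subset h)⟩, rfl⟩

/-- Fibres near `z` lie in a finite union of neighbourhoods of the points over `z`, each generically
containing at most `localMultiplicity` points. The generic condition `P` and the local condition `Q`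
stay separate so that all components can be treated before one common `y` is chosen. -/
theorem exists_holdsGenerically_eventually_ncard_le {X : Type*} [TopologicalSpace X]
    [CompactSpace X] {Γ : Set (X × X)} (hΓ : IsClosed Γ) {d : ℕ}
    (hd : HoldsGenerically fun z : X => {w : X | (w, z) ∈ Γ}.encard ≤ (d : ℕ∞)) {z : X}
    {s : Finset X} (hs : ∀ w, w ∈ s ↔ (w, z) ∈ Γ) :
    ∃ P Q : X → Prop, HoldsGenerically P ∧ (∀ᶠ y in 𝓝 z, Q y) ∧ ∀ y, P y → Q y →
      {w : X | (w, y) ∈ Γ}.ncard ≤ ∑ w ∈ s, localMultiplicity Γ (w, z) := by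
  choose U hU hUP using exists_nhds_holdsGenerically_encard_le_localMultiplicity hd
  refine ⟨_, _, HoldsGenerically.finset_forall s fun w _ => hUP (w, z),
    eventually_fibre_subset hΓ (z := z) (U := ⋃ w ∈ s, U (w, z)) fun w hw =>
      mem_of_superset (hU (w, z)) (subset_biUnion_of_mem (u := fun w => U (w, z))
        ((hs w).2 hw)), fun y hP hQ => ?_⟩
  have hsub : {w : X | (w, y) ∈ Γ} ⊆ ⋃ v ∈ s, {w : X | (w, y) ∈ Γ ∧ (w, y) ∈ U (v, z)} := by
    intro w hw
    have := hQ w hw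
    simp only [mem_iUnion] at this ⊢
    obtain ⟨v, hv, h⟩ := this
    exact ⟨v, hv, hw, h⟩
  have hle : ∀ v ∈ s, {w : X | (w, y) ∈ Γ ∧ (w, y) ∈ U (v, z)}.ncard ≤
      localMultiplicity Γ (v, z) := fun v hv => by
    have := ENat.toNat_le_toNat (hP v hv) (ENat.natCast_ne_top _)
    simpa [ncard] using this
  have hfin : (⋃ v ∈ s, {w : X | (w, y) ∈ Γ ∧ (w, y) ∈ U (v, z)}).Finite :=
    s.finite_toSet.biUnion fun v hv => finite_of_encard_le_coe (hP v hv)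
  refine (ncard_le_ncard hsub hfin).trans (le_trans ?_ (Finset.sum_le_sum hle))
  exact Finset.set_ncard_biUnion_le _ _

/-! ### Fibres, the lower bound for the weighted number of preimages, and the preimage measures. -/

namespace HolomorphicCorrespondence

variable {k : ℕ} {X : Type*} [TopologicalSpace X] [ChartedSpace (EuclideanSpace ℂ (Fin k)) X]

theorem isClosed_component (F : HolomorphicCorrespondence k X) (j : Fin F.N) :
    IsClosed (F.Γ j) :=
  (F.irreducible j).1.isClosed

/-- The fibre of the `j`-th component over `z`, under the second projection. -/
noncomputable def fibre (F : HolomorphicCorrespondence k X) (j : Fin F.N) (z : X) : Finset X :=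
  (F.finite_preimage j z).toFinset

theorem mem_fibre (F : HolomorphicCorrespondence k X) {j : Fin F.N} {z w : X} :
    w ∈ F.fibre j z ↔ (w, z) ∈ F.Γ j := by
  simp [fibre]

theorem preimageSum_eq (F : HolomorphicCorrespondence k X) (φ : X → ℝ) (z : X) :
    F.preimageSum φ z = ∑ j, (F.mult j : ℝ) *
      ∑ w ∈ F.fibre j z, (localMultiplicity (F.Γ j) (w, z) : ℝ) * φ w := by
  unfold preimageSum
  congr 1 with j
  congr 1
  rw [← finsum_mem_finset_eq_sum]
  refine finsum_congr fun w => ?_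
  simp only [mem_fibre]; rfl

theorem one_le_preimageSum_one (F : HolomorphicCorrespondence k X) (z : X) :
    1 ≤ F.preimageSum (fun _ => 1) z := by
  rw [preimageSum_eq]
  have hnn : ∀ j, 0 ≤ (F.mult j : ℝ) *
      ∑ w ∈ F.fibre j z, (localMultiplicity (F.Γ j) (w, z) : ℝ) * 1 := fun j => by positivity
  refine le_trans ?_ (Finset.single_le_sum (fun j _ => hnn j) (Finset.mem_univ ⟨0, F.N_pos⟩))
  obtain ⟨⟨w, y⟩, hw, rfl⟩ : z ∈ Prod.snd '' F.Γ ⟨0, F.N_pos⟩ := F.surj_snd _ ▸ mem_univ z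
  refine one_le_mul_of_one_le_of_one_le (by exact_mod_cast F.mult_pos _) ?_
  refine le_trans ?_ (Finset.single_le_sum (fun _ _ => by positivity) (F.mem_fibre.2 hw))
  rw [mul_one]
  exact_mod_cast le_max_left _ _

theorem topDegree_le_preimageSum_one [CompactSpace X] (F : HolomorphicCorrespondence k X)
    (z : X) : (F.topDegree : ℝ) ≤ F.preimageSum (fun _ => 1) z := by
  -- The value `0` may be the default of `sInf` on the empty set; a positive value is attained
  -- generically.
  rcases Nat.eq_zero_or_pos F.topDegree with h0 | hpos
  · rw [h0]
    exact_mod_cast zero_le_one.trans (F.one_le_preimageSum_one z)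
  have hgen : HoldsGenerically fun z : X =>
      ∑ j, F.mult j * {w : X | (w, z) ∈ F.Γ j}.ncard = F.topDegree :=
    Nat.sInf_mem (Nat.nonempty_of_pos_sInf hpos)
  have hbd : ∀ j, HoldsGenerically fun z : X =>
      {w : X | (w, z) ∈ F.Γ j}.encard ≤ (F.topDegree : ℕ∞) := fun j => hgen.mono fun y hy => by
    rw [← (F.finite_preimage j y).cast_ncard_eq, Nat.cast_le, ← hy]
    refine (Nat.le_mul_of_pos_left _ (F.mult_pos j)).trans ?_
    exact Finset.single_le_sum (f := fun j => F.mult j * {w : X | (w, y) ∈ F.Γ j}.ncard)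
      (fun _ _ => Nat.zero_le _) (Finset.mem_univ j)
  choose P Q hP hQ hPQ using fun j => exists_holdsGenerically_eventually_ncard_le
    (F.isClosed_component j) (hbd j) (z := z) (s := F.fibre j z) (fun w => F.mem_fibre)
  obtain ⟨y, ⟨hy, hyP⟩, hyQ⟩ :=
    (hgen.and (HoldsGenerically.finset_forall Finset.univ fun j _ => hP j)).exists_of_eventually
      (eventually_all.2 hQ)
  rw [preimageSum_eq, ← hy]
  push_cast
  refine Finset.sum_le_sum fun j _ => mul_le_mul_of_nonneg_left ?_ (Nat.cast_nonneg _)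
  simp only [mul_one]
  exact_mod_cast hPQ j y (hyP j (Finset.mem_univ j)) (hyQ j)

variable [MeasurableSpace X]

open scoped NNReal in
/-- The normalized sum of the point masses at the preimages of `z`. -/
noncomputable def preimageMeasure (F : HolomorphicCorrespondence k X) (z : X) : Measure X :=
  ((F.topDegree : ℝ≥0)⁻¹) • ∑ j, ∑ w ∈ F.fibre j z,
    ((F.mult j * localMultiplicity (F.Γ j) (w, z) : ℕ) : ℝ≥0) • Measure.dirac w

instance (F : HolomorphicCorrespondence k X) (z : X) : IsFiniteMeasure (F.preimageMeasure z) := by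
  unfold preimageMeasure
  infer_instance

theorem integral_preimageMeasure [MeasurableSingletonClass X] (F : HolomorphicCorrespondence k X)
    (f : X → ℝ) (z : X) :
    ∫ w, f w ∂F.preimageMeasure z = (F.topDegree : ℝ)⁻¹ * F.preimageSum f z := by
  have hint : ∀ (c : NNReal) (w : X), Integrable f (c • Measure.dirac w) := fun c w =>
    (integrable_dirac (by simp)).smul_measure_nnreal
  rw [preimageMeasure, integral_smul_nnreal_measure, preimageSum_eq,
    integral_finsetSum_measure fun j _ => integrable_finsetSum_measure.2 fun w _ => hint _ w]
  simp_rw [integral_finsetSum_measure fun w _ => hint _ w, integral_smul_nnreal_measure,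
    integral_dirac, NNReal.smul_def, Finset.mul_sum]
  simp [mul_assoc, Finset.mul_sum]

/-- Every point of the fibre is an atom, its multiplicity being at least `1`. This turns almost sure
invariance under the kernel into the set inclusion required by `AlmostInvariant`. -/
theorem forall_of_ae_preimageMeasure [MeasurableSingletonClass X]
    (F : HolomorphicCorrespondence k X) (hd : 0 < F.topDegree) {z : X} {p : X → Prop}
    (h : ∀ᵐ w ∂F.preimageMeasure z, p w) {w : X} (hw : (w, z) ∈ F.support) : p w := by
  obtain ⟨j, hj⟩ := mem_iUnion.1 hw
  by_contra hp
  have h0 : F.preimageMeasure z {w} = 0 := measure_mono_null (by simpa using hp) h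
  have hmul : 0 < F.mult j * localMultiplicity (F.Γ j) (w, z) :=
    Nat.mul_pos (F.mult_pos j) (lt_of_lt_of_le one_pos (le_max_left _ _))
  rw [preimageMeasure, Measure.smul_apply, Measure.finsetSum_apply] at h0
  simp only [Measure.finsetSum_apply, Measure.smul_apply, ENNReal.smul_def, smul_eq_mul,
    mul_eq_zero, Finset.sum_eq_zero_iff] at h0
  rcases h0 with h0 | h0
  · simp [hd.ne'] at h0
  · rcases h0 j (Finset.mem_univ _) w (F.mem_fibre.2 hj) with h | h
    · simp only [ENNReal.coe_eq_zero, Nat.cast_eq_zero] at h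
      omega
    · simp at h

end HolomorphicCorrespondence

/-! ### Consequences of invariance: mass one, stationarity and a measurable kernel. -/

namespace HolomorphicCorrespondence

variable {k : ℕ} {X : Type*} [TopologicalSpace X] [ChartedSpace (EuclideanSpace ℂ (Fin k)) X]
  [MeasurableSpace X] {F : HolomorphicCorrespondence k X} {μ : Measure X}

theorem IsPullbackInvariant.topDegree_pos [IsProbabilityMeasure μ]
    (hinv : F.IsPullbackInvariant μ) : 0 < F.topDegree := by
  obtain ⟨hint, heq⟩ := hinv 1
  have : (1 : ℝ) ≤ ∫ z, F.preimageSum (1 : C(X, ℝ)) z ∂μ := by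
    calc (1 : ℝ) = ∫ _, 1 ∂μ := by simp
      _ ≤ _ := integral_mono (integrable_const _) hint fun z => F.one_le_preimageSum_one z
  rw [heq] at this
  rcases Nat.eq_zero_or_pos F.topDegree with h | h
  · rw [h] at this; norm_num at this
  · exact h

/-- The pointwise inequality `topDegree_le_preimageSum_one` integrates to an equality, hence is an
equality almost everywhere. -/
theorem IsPullbackInvariant.ae_preimageSum_one_eq [CompactSpace X] [IsProbabilityMeasure μ]
    (hinv : F.IsPullbackInvariant μ) :
    ∀ᵐ z ∂μ, F.preimageSum (fun _ => 1) z = F.topDegree := by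
  obtain ⟨hint, heq⟩ := hinv 1
  have h := (integral_eq_iff_of_ae_le (integrable_const (F.topDegree : ℝ)) hint
    (ae_of_all μ fun z => F.topDegree_le_preimageSum_one z)).1 (by
      refine Eq.trans ?_ heq.symm
      simp)
  exact h.symm

theorem IsPullbackInvariant.ae_preimageMeasure_univ [CompactSpace X] [MeasurableSingletonClass X]
    [IsProbabilityMeasure μ] (hinv : F.IsPullbackInvariant μ) :
    ∀ᵐ z ∂μ, F.preimageMeasure z univ = 1 := by
  filter_upwards [hinv.ae_preimageSum_one_eq] with z hz
  have h := F.integral_preimageMeasure (fun _ => 1) z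
  rw [hz, inv_mul_cancel₀ (by exact_mod_cast hinv.topDegree_pos.ne'), integral_const, smul_eq_mul,
    mul_one] at h
  exact (ENNReal.toReal_eq_one_iff _).1 h

variable [BorelSpace X] [HasOuterApproxClosed X]

theorem IsPullbackInvariant.aemeasurable_preimageMeasure [T1Space X] [SecondCountableTopology X]
    (hinv : F.IsPullbackInvariant μ) : AEMeasurable F.preimageMeasure μ := by
  refine aemeasurable_measure_of_forall_integral fun f => ?_
  simp_rw [integral_preimageMeasure]
  exact (hinv f.toContinuousMap).1.aestronglyMeasurable.aemeasurable.const_mul _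

open ProbabilityTheory in
theorem IsPullbackInvariant.bind_eq [T1Space X] [IsProbabilityMeasure μ]
    (hinv : F.IsPullbackInvariant μ) {κ : Kernel X X} [IsFiniteKernel κ]
    (hκ : F.preimageMeasure =ᵐ[μ] κ) : μ.bind κ = μ := by
  have h₂ : (μ ⊗ₘ κ).snd = μ.bind κ := Measure.snd_compProd μ κ
  rw [← h₂]
  refine ext_of_forall_integral_eq_of_IsFiniteMeasure fun f => ?_
  have hint : Integrable (fun p : X × X => f p.2) (μ ⊗ₘ κ) :=
    (f.integrable ((μ ⊗ₘ κ).snd)).comp_measurable measurable_snd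
  calc ∫ x, f x ∂(μ ⊗ₘ κ).snd = ∫ p, f p.2 ∂(μ ⊗ₘ κ) :=
        integral_map measurable_snd.aemeasurable f.continuous.aestronglyMeasurable
    _ = ∫ z, ∫ w, f w ∂κ z ∂μ := Measure.integral_compProd hint
    _ = ∫ z, (F.topDegree : ℝ)⁻¹ * F.preimageSum f.toContinuousMap z ∂μ := by
        refine integral_congr_ae ?_
        filter_upwards [hκ] with z hz
        rw [← hz]
        exact F.integral_preimageMeasure f z
    _ = ∫ z, f z ∂μ := by
        rw [integral_const_mul, (hinv f.toContinuousMap).2, inv_mul_cancel_left₀]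
        · rfl
        · exact_mod_cast hinv.topDegree_pos.ne'

open ProbabilityTheory in
/-- A measurable version of `preimageMeasure`, which vanishes on a null set. -/
theorem IsPullbackInvariant.exists_kernel [CompactSpace X] [T1Space X] [SecondCountableTopology X]
    [IsProbabilityMeasure μ] (hinv : F.IsPullbackInvariant μ) :
    ∃ (κ : Kernel X X) (Z : Set X), MeasurableSet Z ∧ μ Zᶜ = 0 ∧
      (∀ z ∈ Z, κ z = F.preimageMeasure z ∧ κ z univ = 1) ∧ ∀ z ∉ Z, κ z = 0 := by
  classical
  have hm := hinv.aemeasurable_preimageMeasure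
  obtain ⟨Z, hZsub, hZm, hZ⟩ := exists_measurable_superset_of_null
    (s := {z | ¬ (F.preimageMeasure z = hm.mk _ z ∧ F.preimageMeasure z univ = 1)})
    (hm.ae_eq_mk.and hinv.ae_preimageMeasure_univ)
  have hZ' : ∀ z ∉ Z, F.preimageMeasure z = hm.mk _ z ∧ F.preimageMeasure z univ = 1 :=
    fun z hz => by
      by_contra hc
      exact hz (hZsub hc)
  refine ⟨⟨Z.piecewise (fun _ => 0) (hm.mk _),
    Measurable.piecewise hZm measurable_const hm.measurable_mk⟩, Zᶜ, hZm.compl, by simpa using hZ,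
    fun z hz => ?_, fun z hz => ?_⟩
  · have e : Z.piecewise (fun _ => (0 : Measure X)) (hm.mk _) z = F.preimageMeasure z := by
      rw [piecewise_eq_of_notMem _ _ _ hz, (hZ' z hz).1]
    exact ⟨e, (congrArg (fun m : Measure X => m univ) e).trans (hZ' z hz).2⟩
  · exact piecewise_eq_of_mem Z (fun _ => (0 : Measure X)) (hm.mk _) (by simpa using hz)

end HolomorphicCorrespondence

/-! ### Comparison of the iterates of the averaging operator with the sets `F^j(A)`. -/

theorem proposition4 {k : ℕ} {X : Type*} [TopologicalSpace X] [T2Space X] [CompactSpace X]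
    [ConnectedSpace X] [ChartedSpace (EuclideanSpace ℂ (Fin k)) X]
    [IsManifold 𝓘(ℂ, EuclideanSpace ℂ (Fin k)) ω X] [MeasurableSpace X] [BorelSpace X]
    (F : HolomorphicCorrespondence k X) (μ : Measure X) [IsProbabilityMeasure μ]
    (hinv : F.IsPullbackInvariant μ) (herg : F.IsErgodic μ)
    (A B : Set X) (hA : MeasurableSet A) (hB : MeasurableSet B) (L : ℝ)
    (hL : Tendsto (fun n : ℕ => (1 / (n : ℝ)) * ∑ j ∈ Finset.range n, μ.real (F.image^[j] A ∩ B))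
      atTop (𝓝 L)) :
    μ.real A * μ.real B ≤ L := by
  have : SecondCountableTopology X :=
    ChartedSpace.secondCountable_of_sigmaCompact (EuclideanSpace ℂ (Fin k)) X
  have : TopologicalSpace.MetrizableSpace X :=
    TopologicalSpace.metrizableSpace_of_t3_secondCountable X
  obtain ⟨κ, Z, hZm, hZ, hκ, hκ0⟩ := hinv.exists_kernel
  have hZae : ∀ᵐ z ∂μ, z ∈ Z := hZ
  have hle : ∀ z, κ z univ ≤ 1 := fun z => by
    by_cases hz : z ∈ Z
    · exact (hκ z hz).2.le
    · simp [hκ0 z hz]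
  have : ProbabilityTheory.IsFiniteKernel κ := ⟨1, ENNReal.one_lt_top, hle⟩
  let u : ℕ → X → ℝ := fun j => (fun f z => ∫ w, f w ∂κ z)^[j] (A.indicator fun _ => 1)
  have husucc : ∀ j z, u (j + 1) z = ∫ w, u j w ∂κ z := fun j z => by
    simp only [u, Function.iterate_succ_apply']
  have hum : Measurable (u 0) := measurable_const.indicator hA
  have hu0 : ∀ z, u 0 z ∈ Icc (0 : ℝ) 1 := fun z =>
    ⟨indicator_nonneg (fun _ _ => zero_le_one) z, indicator_le_self' (fun _ _ => zero_le_one) z⟩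
  have hprop := stronglyMeasurable_and_mem_Icc_of_kernel_iterate hle hum hu0 husucc
  have hsupp : ∀ j z, u j z ≠ 0 → z ∈ F.image^[j] A := fun j => by
    induction j with
    | zero => exact fun z hz => mem_of_indicator_ne_zero hz
    | succ j ih =>
      intro z hz
      rw [husucc] at hz
      -- Off `Z` the kernel is zero, so `u (j + 1)` vanishes there and the support claim holds at
      -- every point.
      have hzZ : z ∈ Z := by
        by_contra hzZ
        simp [hκ0 z hzZ] at hz
      rw [(hκ z hzZ).1, F.integral_preimageMeasure, F.preimageSum_eq] at hz
      obtain ⟨i, -, hi⟩ := Finset.exists_ne_zero_of_sum_ne_zero (right_ne_zero_of_mul hz)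
      obtain ⟨w, hw, hwu⟩ := Finset.exists_ne_zero_of_sum_ne_zero (right_ne_zero_of_mul hi)
      rw [Function.iterate_succ_apply']
      exact ⟨(w, z), ⟨ih w (right_ne_zero_of_mul hwu), mem_iUnion.2 ⟨i, F.mem_fibre.1 hw⟩⟩, rfl⟩
  have hlim := tendsto_cesaro_setIntegral_kernel hle (hZae.mono fun z hz => (hκ z hz).2)
    (hinv.bind_eq (hZae.mono fun z hz => (hκ z hz).1.symm)) (fun C hC hCinv => by
      -- Removing a measurable null set of bad points from `C` gives the subset required by
      -- `AlmostInvariant`.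
      obtain ⟨N, hNsub, hNm, hN⟩ := exists_measurable_superset_of_null (hCinv.and hZae)
      refine herg C hC ⟨C \ N, hC.diff hNm, sdiff_subset, (measure_sdiff_null hN).symm, ?_⟩
      rintro _ ⟨⟨w, z⟩, ⟨⟨hzC, hzN⟩, hwz⟩, rfl⟩
      have hz : (z ∈ C → ∀ᵐ w ∂κ z, w ∈ C) ∧ z ∈ Z := by
        by_contra hc
        exact hzN (hNsub hc)
      have hae := hz.1 hzC
      rw [(hκ z hz.2).1] at hae
      exact F.forall_of_ae_preimageMeasure hinv.topDegree_pos hae hwz) hum hu0 husucc hB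
  have hint0 : ∫ z, u 0 z ∂μ = μ.real A := integral_indicator_one hA
  rw [hint0] at hlim
  refine le_of_tendsto_of_tendsto' hlim hL fun n => ?_
  refine mul_le_mul_of_nonneg_left (Finset.sum_le_sum fun j _ => ?_) (by positivity)
  -- The set `F^j(A)` is not known to be Borel, so a measurable hull of equal measure replaces the
  -- intersection.
  set M := toMeasurable μ (F.image^[j] A ∩ B) with hM
  have hMm : MeasurableSet M := measurableSet_toMeasurable _ _
  calc ∫ z in B, u j z ∂μ = ∫ z, B.indicator (u j) z ∂μ := (integral_indicator hB).symm
    _ ≤ ∫ z, M.indicator 1 z ∂μ := by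
        refine integral_mono_of_nonneg
          (ae_of_all _ fun z => indicator_nonneg (fun z _ => ((hprop j).2 z).1) z)
          ((integrable_const (1 : ℝ)).indicator hMm) (ae_of_all _ fun z => ?_)
        by_cases hz : z ∈ B ∧ u j z ≠ 0
        · have hzM : z ∈ M := subset_toMeasurable _ _ ⟨hsupp j z hz.2, hz.1⟩
          simpa [hz.1, hzM] using ((hprop j).2 z).2
        · have h0 : B.indicator (u j) z = 0 := by
            simp only [indicator_apply_eq_zero]
            tauto
          rw [h0]
          exact indicator_nonneg (fun _ _ => zero_le_one) z
    _ = μ.real (F.image^[j] A ∩ B) := by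
        rw [integral_indicator_one hMm, measureReal_def, measureReal_def, hM, measure_toMeasurable]
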